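/- Let $M$ be a smooth manifold (Hausdorff, second countable, without boundary, of some dimension $m$) and let $(L,\rho,\nabla)\to M$ be a Hermitian line bundle, i.e. $L\to M$ is a smooth complex line bundle, $\rho$ is a smooth Hermitian metric on $L$, and $\nabla$ is a smooth ($\mathbb{C}$-linear) $\rho$-compatible connection on $L$. Let $M'=M\setminus(V_1\cup\dots\cup V_\ell)$ be the complement of finitely many closed (as subsets) embedded submanifolds $V_1,\dots,V_\ell\subset M$, each of real codimension at least $\mathfrak{c}$. For $U\subset M$ open and $0\le r\le\infty$, a $C^r$ trivialization of $L|_U$ is a $C^r$ map $\Phi\colon L|_U\to\mathbb{C}$ that restricts to a $\mathbb{C}$-linear isomorphism $L_x\to\mathbb{C}$ for every $x\in U$. Two such trivializations $\Phi_0,\Phi_1$ are $C^r$ homotopic if there is a $C^r$ map $F\colon[0,1]\times L|_U\to\mathbb{C}$ such that $F(0,\cdot)=\Phi_0$, $F(1,\cdot)=\Phi_1$, and $F(t,\cdot)$ is a $C^r$ trivialization of $L|_U$ for every $t\in[0,1]$. (Here $r=0$ means continuous and $r=\infty$ means smooth.) 1. If $\mathfrak{c}\ge2$ and $0\le r\le\infty$,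 any two $C^r$ trivializations of $L$ over $M$ whose restrictions to $L|_{M'}$ are $C^r$ homotopic as trivializations of $L|_{M'}$ are $C^r$ homotopic as trivializations of $L$ over $M$. 2. If $\mathfrak{c}\ge3$, every smooth trivialization of $L|_{M'}$ is smoothly homotopic, through trivializations of $L|_{M'}$, to the restriction of a smooth trivialization of $L$ over $M$. -/

import Mathlib

open Set Bundle
open scoped Manifold ContDiff

-- A Hermitian inner product on the fibers is regarded as a real inner product through its real
-- part. The Hermitian metric is smooth exactly when this real part is a smooth Riemannian metric.
attribute [local instance] InnerProductSpace.complexToReal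

theorem VectorBundle.isLinear_real {B F : Type*} {E : B → Type*} [TopologicalSpace B]
    [NormedAddCommGroup F] [NormedSpace ℂ F] [TopologicalSpace (TotalSpace F E)]
    [∀ x, NormedAddCommGroup (E x)] [∀ x, InnerProductSpace ℂ (E x)]
    [FiberBundle F E] [VectorBundle ℂ F E]
    (e : Trivialization F (π F E)) [MemTrivializationAtlas e] : e.IsLinear ℝ := by
  have h := VectorBundle.trivialization_linear' (R := ℂ) e
  refine ⟨fun b hb => ⟨(h.linear b hb).map_add, fun c x => ?_⟩⟩
  have := (h.linear b hb).map_smul (c : ℂ) x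
  simpa using this

/-- A complex vector bundle is a real vector bundle with the same local trivializations. -/
instance VectorBundle.complexToReal {B F : Type*} {E : B → Type*} [TopologicalSpace B]
    [NormedAddCommGroup F] [NormedSpace ℂ F] [TopologicalSpace (TotalSpace F E)]
    [∀ x, NormedAddCommGroup (E x)] [∀ x, InnerProductSpace ℂ (E x)]
    [FiberBundle F E] [VectorBundle ℂ F E] : VectorBundle ℝ F E where
  trivialization_linear' e _ := VectorBundle.isLinear_real e
  continuousOn_coordChange' e e' _ _ := by
    have := VectorBundle.isLinear_real e
    have := VectorBundle.isLinear_real e'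
    have h := VectorBundle.continuousOn_coordChange' (R := ℂ) e e'
    have h2 := (ContinuousLinearMap.restrictScalarsL ℂ F F ℝ ℝ).continuous.comp_continuousOn h
    refine h2.congr fun b hb => ?_
    ext v
    have h3 := Trivialization.coordChangeL_apply (R := ℝ) e e' hb v
    have h4 := Trivialization.coordChangeL_apply (R := ℂ) e e' hb v
    exact h3.trans h4.symm

/-- `V` is a closed subset of the `m`-manifold `M` and an embedded submanifold of codimension `d`:
near each of its points there is a smooth chart of `M` carrying `V` to a linear subspace of
codimension `d`. -/
def IsClosedSubmanifold (m : ℕ) {M : Type*} [TopologicalSpace M]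
    [ChartedSpace (EuclideanSpace ℝ (Fin m)) M] (d : ℕ) (V : Set M) : Prop :=
  IsClosed V ∧ ∀ x ∈ V, ∃ φ ∈ IsManifold.maximalAtlas (𝓡 m) ∞ M, x ∈ φ.source ∧
    ∃ W : Submodule ℝ (EuclideanSpace ℝ (Fin m)), Module.finrank ℝ W + d = m ∧
      ∀ y ∈ φ.source, y ∈ V ↔ φ y ∈ W

/-- A smooth, complex linear connection that is compatible with the metric. -/
structure IsHermitianConnection {m : ℕ} {M : Type*} [TopologicalSpace M]
    [ChartedSpace (EuclideanSpace ℝ (Fin m)) M] {L : M → Type*}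
    [TopologicalSpace (TotalSpace ℂ L)] [∀ x, NormedAddCommGroup (L x)]
    [∀ x, InnerProductSpace ℂ (L x)] [FiberBundle ℂ L] [VectorBundle ℂ ℂ L]
    [IsManifold (𝓡 m) ∞ M] [ContMDiffVectorBundle ∞ ℂ L (𝓡 m)]
    [IsContMDiffRiemannianBundle (𝓡 m) ∞ ℂ L] (D : CovariantDerivative (𝓡 m) ℂ L) : Prop where
  contMDiff : D.ContMDiffCovariantDerivative ∞
  map_I_smul : ∀ (σ : Π x, L x) (x : M),
    MDifferentiableAt (𝓡 m) ((𝓡 m).prod 𝓘(ℝ, ℂ)) (fun y => TotalSpace.mk' ℂ y (σ y)) x →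
    ∀ v : TangentSpace (𝓡 m) x,
      D (fun y => Complex.I • σ y) x v = Complex.I • D σ x v
  metric : D.IsMetricCompatible

/-- The function `Φ`, on the part of the total space of `L` over `U`, is a `C^r` trivialization of
the complex line bundle `L|_U`: it is `C^r` and is a complex linear isomorphism onto `ℂ` on each
fiber over `U`. Here `r = 0` means continuous. The values of `Φ` outside `L|_U` are irrelevant,
so the same `Φ` represents the restrictions of a trivialization to smaller sets. -/
def IsTrivializationOn (m : ℕ) {M : Type*} [TopologicalSpace M]
    [ChartedSpace (EuclideanSpace ℝ (Fin m)) M] {L : M → Type*}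
    [TopologicalSpace (TotalSpace ℂ L)] [∀ x, NormedAddCommGroup (L x)]
    [∀ x, InnerProductSpace ℂ (L x)] [FiberBundle ℂ L] [VectorBundle ℂ ℂ L]
    (r : ℕ∞) (U : Set M) (Φ : TotalSpace ℂ L → ℂ) : Prop :=
  ContMDiffOn ((𝓡 m).prod 𝓘(ℝ, ℂ)) 𝓘(ℝ, ℂ) r Φ (π ℂ L ⁻¹' U) ∧
    ∀ x ∈ U, ∃ e : L x ≃ₗ[ℂ] ℂ, ∀ v : L x, Φ ⟨x, v⟩ = e v

/-- `Φ₀` and `Φ₁` are `C^r` homotopic over `U`, through trivializations of `L|_U`. -/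
def TrivializationsHomotopicOn (m : ℕ) {M : Type*} [TopologicalSpace M]
    [ChartedSpace (EuclideanSpace ℝ (Fin m)) M] {L : M → Type*}
    [TopologicalSpace (TotalSpace ℂ L)] [∀ x, NormedAddCommGroup (L x)]
    [∀ x, InnerProductSpace ℂ (L x)] [FiberBundle ℂ L] [VectorBundle ℂ ℂ L]
    (r : ℕ∞) (U : Set M) (Φ₀ Φ₁ : TotalSpace ℂ L → ℂ) : Prop :=
  ∃ F : ℝ → TotalSpace ℂ L → ℂ,
    ContMDiffOn (𝓘(ℝ, ℝ).prod ((𝓡 m).prod 𝓘(ℝ, ℂ))) 𝓘(ℝ, ℂ) r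
      (fun p : ℝ × TotalSpace ℂ L => F p.1 p.2) (Icc 0 1 ×ˢ (π ℂ L ⁻¹' U)) ∧
    (∀ t ∈ Icc (0 : ℝ) 1, IsTrivializationOn m r U (F t)) ∧
    (∀ p ∈ π ℂ L ⁻¹' U, F 0 p = Φ₀ p) ∧ ∀ p ∈ π ℂ L ⁻¹' U, F 1 p = Φ₁ p

/-! ### Continuous logarithms of nowhere zero functions -/

section

open Topology Filter

/-! Two trivializations of a line bundle differ by a function with values in `ℂ \ {0}`. They are
homotopic exactly when this ratio has a logarithm `f`: a homotopy lifts through the covering `exp`,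
and conversely `exp (t f)` is a homotopy. A continuous logarithm of a `C^r` function is itself
`C^r`, so only continuity has to be studied.

Codimension two: the ratio is defined on all of `M` and has a logarithm off `V`. Near a point of `V`
it also has a local logarithm. The two differ by a constant, because the complement of `V` in a
small ball is connected, so the logarithm extends across `V`
(`IsClosedSubmanifold.exists_log_extension`).

Codimension three: compare `Φ` with local trivializations `φ i` of `L`. The complement of `V` in a
ball is simply connected, so `Φ = exp (f i) * φ i` off `V`. The differences `f i - f j` are
logarithms of `φ j / φ i`, hence extend across `V` and form a smooth additive cocycle. A partition
of unity writes it as `b j - b i`. Then the `exp (-b i) * φ i` glue to a trivialization `Ψ`, and the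
`b i + f i` glue to a logarithm of `Φ / Ψ` (`IsClosedSubmanifold.exists_trivialization_extension`).

Several submanifolds are treated one at a time, by induction. -/

theorem ContinuousOn.exists_log_of_homotopy {X : Type*} [TopologicalSpace X] {S : Set X}
    {H : ℝ → X → ℂ} (hH : ContinuousOn (fun p : ℝ × X => H p.1 p.2) (Icc 0 1 ×ˢ S))
    (hne : ∀ t ∈ Icc (0 : ℝ) 1, ∀ x ∈ S, H t x ≠ 0) (h0 : ∀ x ∈ S, H 0 x = 1) :
    ∃ f : X → ℂ, ContinuousOn f S ∧ ∀ x ∈ S, Complex.exp (f x) = H 1 x := by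
  classical
  let G : C(unitInterval × S, {z : ℂ // z ≠ 0}) :=
    ⟨fun p => ⟨H p.1 p.2, hne _ p.1.2 _ p.2.2⟩, by
      refine Continuous.subtype_mk ?_ _
      exact hH.comp_continuous (f := fun p : unitInterval × S => ((p.1 : ℝ), (p.2 : X)))
        (by fun_prop) fun p => ⟨p.1.2, p.2.2⟩⟩
  have hG0 : ∀ a : S, G (0, a) = ⟨_, Complex.exp_ne_zero ((0 : C(S, ℂ)) a)⟩ := fun a =>
    Subtype.ext (by simpa [G] using h0 a a.2)
  let K := Complex.isCoveringMap_exp.liftHomotopy G 0 hG0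
  have hK := Complex.isCoveringMap_exp.liftHomotopy_lifts G 0 hG0
  refine ⟨fun x => if hx : x ∈ S then K (1, ⟨x, hx⟩) else 0, ?_, fun x hx => ?_⟩
  · rw [continuousOn_iff_continuous_domRestrict]
    have : Continuous fun x : S => K (1, x) := by fun_prop
    refine this.congr fun x => ?_
    simp [Set.domRestrict]
  · have := congrArg Subtype.val (congrFun hK (1, ⟨x, hx⟩))
    simpa [hx, G, K] using this

/-- Contracting `S` to `p` deforms the constant `1` into `g / g p`. -/
theorem StarConvex.exists_continuousOn_log {E : Type*} [AddCommGroup E] [Module ℝ E]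
    [TopologicalSpace E] [IsTopologicalAddGroup E] [ContinuousSMul ℝ E] {p : E} {S : Set E}
    (hS : StarConvex ℝ p S) (hp : p ∈ S) {g : E → ℂ} (hg : ContinuousOn g S)
    (hne : ∀ x ∈ S, g x ≠ 0) :
    ∃ f : E → ℂ, ContinuousOn f S ∧ ∀ x ∈ S, Complex.exp (f x) = g x := by
  have hm : ∀ t ∈ Icc (0 : ℝ) 1, ∀ x ∈ S, p + t • (x - p) ∈ S := fun t ht x hx =>
    hS.add_smul_sub_mem hx ht.1 ht.2
  obtain ⟨f, hf, hfe⟩ := ContinuousOn.exists_log_of_homotopy (S := S)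
    (H := fun t x => g (p + t • (x - p)) / g p)
    (by
      refine ContinuousOn.div_const ?_ _
      exact hg.comp (f := fun q : ℝ × E => p + q.1 • (q.2 - p)) (by fun_prop)
        fun q hq => hm _ hq.1 _ hq.2)
    (fun t ht x hx => div_ne_zero (hne _ (hm t ht x hx)) (hne p hp))
    (fun x _ => by simp [hne p hp])
  refine ⟨fun x => f x + Complex.log (g p), hf.add continuousOn_const, fun x hx => ?_⟩
  rw [Complex.exp_add, hfe x hx, Complex.exp_log (hne p hp)]
  simp [hne p hp]

/-- Uniqueness of lifts through the covering `exp`, applied to `f₁` and a translate of `f₂`. -/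
theorem IsPreconnected.exists_eq_add_of_exp_eq {X : Type*} [TopologicalSpace X] {S : Set X}
    (hS : IsPreconnected S) {f₁ f₂ : X → ℂ} (h₁ : ContinuousOn f₁ S) (h₂ : ContinuousOn f₂ S)
    (he : ∀ x ∈ S, Complex.exp (f₁ x) = Complex.exp (f₂ x)) :
    ∃ c : ℂ, Complex.exp c = 1 ∧ ∀ x ∈ S, f₁ x = f₂ x + c := by
  obtain rfl | ⟨x₀, hx₀⟩ := S.eq_empty_or_nonempty
  · exact ⟨0, by simp⟩
  have hc : Complex.exp (f₁ x₀ - f₂ x₀) = 1 := by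
    rw [Complex.exp_sub, he _ hx₀, div_self (Complex.exp_ne_zero _)]
  refine ⟨f₁ x₀ - f₂ x₀, hc, ?_⟩
  refine Complex.isCoveringMap_exp.eqOn_of_comp_eqOn hS h₁ (h₂.add continuousOn_const) ?_ hx₀ ?_
  · intro x hx
    refine Subtype.ext ?_
    simp only [Function.comp]
    rw [Complex.exp_add, hc, mul_one, he x hx]
  · ring

/-! ### The linear model: complements of subspaces -/

/-- When `l` vanishes on `W`, the domain is the complement of the half-space `W + ℝ≤0 e`. It is
star-shaped about `e`. -/
theorem Submodule.exists_continuousOn_log_compl_ray {E : Type*} [NormedAddCommGroup E]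
    [NormedSpace ℝ E] [FiniteDimensional ℝ E] (W : Submodule ℝ E) {e : E} (l : E →ₗ[ℝ] ℝ)
    (hle : l e = 1) {g : E → ℂ}
    (hg : ContinuousOn g {x | 0 < l x ∨ x - l x • e ∉ W})
    (hne : ∀ x, 0 < l x ∨ x - l x • e ∉ W → g x ≠ 0) :
    ∃ f : E → ℂ, ContinuousOn f {x | 0 < l x ∨ x - l x • e ∉ W} ∧
      ∀ x, 0 < l x ∨ x - l x • e ∉ W → Complex.exp (f x) = g x := by
  refine StarConvex.exists_continuousOn_log (p := e) ?_ (Or.inl (by simp [hle])) hg hne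
  intro x hx a b ha hb hab
  have hl : l (a • e + b • x) = a + b * l x := by simp [hle]
  have hp : a • e + b • x - l (a • e + b • x) • e = b • (x - l x • e) := by
    rw [hl]; module
  show 0 < l (a • e + b • x) ∨ a • e + b • x - l (a • e + b • x) • e ∉ W
  rw [hp, hl]
  rcases hx with hx | hx
  · left
    rcases ha.eq_or_lt with rfl | ha
    · have : b = 1 := by linarith
      simpa [this] using hx
    · have := mul_nonneg hb hx.le
      linarith
  · rcases hb.eq_or_lt with rfl | hb
    · left; have : a = 1 := by linarith
      simp [this]
    · right
      rwa [W.smul_mem_iff hb.ne']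

theorem Submodule.isPreconnected_compl_of_finrank {E : Type*} [NormedAddCommGroup E]
    [NormedSpace ℝ E] [FiniteDimensional ℝ E] (W : Submodule ℝ E)
    (hW : Module.finrank ℝ W + 2 ≤ Module.finrank ℝ E) : IsPreconnected (Wᶜ : Set E) := by
  refine (isConnected_compl_of_one_lt_codim ?_).isPreconnected
  have := W.finrank_quotient_add_finrank
  rw [← Module.finrank_eq_rank]
  exact_mod_cast (by omega : 1 < Module.finrank ℝ (E ⧸ W))

/-- A van Kampen argument: `Wᶜ` is the union of two star-shaped sets, the slit complements for `e`
and `-e`, whose intersection is connected. The two logarithms therefore differ by a constant and can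
be glued. -/
theorem Submodule.exists_continuousOn_log_compl {E : Type*} [NormedAddCommGroup E]
    [NormedSpace ℝ E] [FiniteDimensional ℝ E] (W : Submodule ℝ E)
    (hW : Module.finrank ℝ W + 3 ≤ Module.finrank ℝ E) {g : E → ℂ}
    (hg : ContinuousOn g (Wᶜ : Set E)) (hne : ∀ x ∉ W, g x ≠ 0) :
    ∃ f : E → ℂ, ContinuousOn f (Wᶜ : Set E) ∧ ∀ x ∉ W, Complex.exp (f x) = g x := by
  classical
  obtain ⟨e, he⟩ : ∃ e, e ∉ W := by
    by_contra! h
    have : W = ⊤ := eq_top_iff.2 fun x _ => h x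
    rw [this, finrank_top] at hW
    omega
  obtain ⟨l₀, hl₀, hWl⟩ := W.exists_le_ker_of_notMem he
  obtain ⟨l, hle, hlW⟩ : ∃ l : E →ₗ[ℝ] ℝ, l e = 1 ∧ ∀ x ∈ W, l x = 0 :=
    ⟨(l₀ e)⁻¹ • l₀, by simp [hl₀], fun x hx => by simp [LinearMap.mem_ker.1 (hWl hx)]⟩
  have hlc : Continuous l := l.continuous_of_finiteDimensional
  have hWc : IsClosed (W : Set E) := W.closed_of_finiteDimensional
  have hQ : IsOpen {x | x - l x • e ∉ W} :=
    (hWc.preimage (by fun_prop : Continuous fun x => x - l x • e)).isOpen_compl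
  have hA : IsOpen {x | 0 < l x ∨ x - l x • e ∉ W} := (isOpen_lt continuous_const hlc).union hQ
  have hB : IsOpen {x | 0 < (-l) x ∨ x - (-l) x • (-e) ∉ W} := by
    have hlc' : Continuous fun x => (-l) x := hlc.neg
    have hQ' : IsOpen {x | x - (-l) x • (-e) ∉ W} := by
      have : {x | x - (-l) x • (-e) ∉ W} = {x | x - l x • e ∉ W} := by ext; simp
      rwa [this]
    exact (isOpen_lt continuous_const hlc').union hQ'
  have hAW : {x | 0 < l x ∨ x - l x • e ∉ W} ⊆ (Wᶜ : Set E) := by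
    rintro x (hx | hx) hxW
    · rw [hlW x hxW] at hx; exact lt_irrefl _ hx
    · rw [hlW x hxW] at hx; exact hx (by simpa using hxW)
  have hBW : {x | 0 < (-l) x ∨ x - (-l) x • (-e) ∉ W} ⊆ (Wᶜ : Set E) := by
    rintro x (hx | hx) hxW
    · simp [hlW x hxW] at hx
    · exact hx (by simpa [hlW x hxW] using hxW)
  obtain ⟨f₁, hf₁, he₁⟩ := W.exists_continuousOn_log_compl_ray l hle (hg.mono hAW)
    (fun x hx => hne x (hAW hx))
  obtain ⟨f₂, hf₂, he₂⟩ := W.exists_continuousOn_log_compl_ray (-l) (e := -e) (by simp [hle])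
    (hg.mono hBW) (fun x hx => hne x (hBW hx))
  -- The intersection of the two pieces is the complement of `W ⊕ ℝ e`. Codimension three of `W`
  -- leaves codimension two here, hence connectedness.
  have hQc : IsPreconnected {x | x - l x • e ∉ W} := by
    have hcard : Module.finrank ℝ (W ⊔ ℝ ∙ e : Submodule ℝ E) ≤ Module.finrank ℝ W + 1 := by
      refine (Submodule.finrank_add_le_finrank_add_finrank _ _).trans ?_
      have := finrank_span_singleton (K := ℝ) (v := e) (by rintro rfl; exact he W.zero_mem)
      omega
    have := (W ⊔ ℝ ∙ e).isPreconnected_compl_of_finrank (by omega)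
    convert this using 1
    ext x
    simp only [mem_ofPred_eq, mem_compl_iff, SetLike.mem_coe, not_iff_not]
    rw [Submodule.mem_sup]
    constructor
    · exact fun h => ⟨_, h, l x • e, Submodule.smul_mem _ _ (Submodule.mem_span_singleton_self e),
        by simp⟩
    · rintro ⟨y, hy, z, hz, rfl⟩
      obtain ⟨a, rfl⟩ := Submodule.mem_span_singleton.1 hz
      simpa [hlW y hy, hle] using hy
  have hQA : {x | x - l x • e ∉ W} ⊆ {x | 0 < l x ∨ x - l x • e ∉ W} := fun x hx => Or.inr hx
  have hQB : {x | x - l x • e ∉ W} ⊆ {x | 0 < (-l) x ∨ x - (-l) x • (-e) ∉ W} := fun x hx =>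
    Or.inr (by simpa using hx)
  obtain ⟨c, hc, hcf⟩ := hQc.exists_eq_add_of_exp_eq (hf₁.mono hQA) (hf₂.mono hQB)
    fun x hx => (he₁ x (hQA hx)).trans (he₂ x (hQB hx)).symm
  have hcov : ∀ x ∉ W, (0 < l x ∨ x - l x • e ∉ W) ∨ (0 < (-l) x ∨ x - (-l) x • (-e) ∉ W) := by
    intro x hx
    by_contra! h
    have h0 : l x = 0 := le_antisymm h.1.1 (by simpa using h.2.1)
    exact hx (by simpa [h0] using h.1.2)
  have hagree : ∀ x, (0 < (-l) x ∨ x - (-l) x • (-e) ∉ W) →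
      (if 0 < l x ∨ x - l x • e ∉ W then f₁ x else f₂ x + c) = f₂ x + c := by
    intro x hx
    split_ifs with h
    · refine hcf x ?_
      show x - l x • e ∉ W
      rcases h with h | h
      · rcases hx with hx | hx
        · rw [LinearMap.neg_apply] at hx; linarith
        · simpa using hx
      · exact h
    · rfl
  refine ⟨fun x => if 0 < l x ∨ x - l x • e ∉ W then f₁ x else f₂ x + c, fun x hx => ?_,
    fun x hx => ?_⟩
  · refine ContinuousAt.continuousWithinAt ?_
    rcases hcov x hx with h | h
    · refine (hf₁.continuousAt (hA.mem_nhds h)).congr ?_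
      filter_upwards [hA.mem_nhds h] with y hy
      exact (if_pos hy).symm
    · refine ((hf₂.continuousAt (hB.mem_nhds h)).add_const c).congr ?_
      filter_upwards [hB.mem_nhds h] with y hy
      exact (hagree y hy).symm
  · rcases hcov x hx with h | h
    · simp only [if_pos h, he₁ x h]
    · simp only [hagree x h, Complex.exp_add, hc, he₂ x h, mul_one]

theorem Submodule.zero_mem_closure_compl {E : Type*} [NormedAddCommGroup E]
    [NormedSpace ℝ E] {W : Submodule ℝ E} (hW : W ≠ ⊤) : (0 : E) ∈ closure (Wᶜ : Set E) := by
  obtain ⟨e, he⟩ : ∃ e, e ∉ W := by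
    by_contra! h
    exact hW (eq_top_iff.2 fun x _ => h x)
  have h : Tendsto (fun t : ℝ => t • e) (𝓝[≠] 0) (𝓝 0) := by
    have : Tendsto (fun t : ℝ => t • e) (𝓝 0) (𝓝 ((0 : ℝ) • e)) :=
      (continuous_id.smul continuous_const).tendsto 0
    rw [zero_smul] at this
    exact this.mono_left nhdsWithin_le_nhds
  refine mem_closure_of_tendsto h ?_
  filter_upwards [self_mem_nhdsWithin] with t ht
  simpa [W.smul_mem_iff (show t ≠ 0 from ht)] using he

/-- `univBall` is a positive radial rescaling followed by translation by `c ∈ W`. -/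
theorem OpenPartialHomeomorph.univBall_mem_iff {E : Type*} [NormedAddCommGroup E]
    [InnerProductSpace ℝ E] (W : Submodule ℝ E) {c : E} (hc : c ∈ W) {r : ℝ} (hr : 0 < r) (v : E) :
    OpenPartialHomeomorph.univBall c r v ∈ W ↔ v ∈ W := by
  have h : OpenPartialHomeomorph.univBall c r v = r • ((√(1 + ‖v‖ ^ 2))⁻¹ • v) + c := by
    rw [univBall, dif_pos hr]
    rfl
  have h2 : (√(1 + ‖v‖ ^ 2))⁻¹ ≠ 0 := by positivity
  rw [h, W.add_mem_iff_left hc, W.smul_mem_iff hr.ne', W.smul_mem_iff h2]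

/-! ### Extending logarithms across submanifolds -/

section

variable {m : ℕ} {M : Type*} [TopologicalSpace M] [ChartedSpace (EuclideanSpace ℝ (Fin m)) M]

/-- Blowing a small chart ball up to the whole space turns `(M, V)` near `x` into the linear model,
with no domain left to track. -/
theorem IsClosedSubmanifold.exists_isOpenEmbedding {d : ℕ} {V : Set M}
    (hV : IsClosedSubmanifold m d V) {x : M} (hx : x ∈ V) {U : Set M} (hU : U ∈ 𝓝 x) :
    ∃ ψ : EuclideanSpace ℝ (Fin m) → M, IsOpenEmbedding ψ ∧ ψ 0 = x ∧ range ψ ⊆ U ∧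
      ∃ W : Submodule ℝ (EuclideanSpace ℝ (Fin m)), Module.finrank ℝ W + d = m ∧
        ∀ v, ψ v ∈ V ↔ v ∈ W := by
  obtain ⟨φ, -, hxφ, W, hW, hVW⟩ := hV.2 x hx
  have hpre : φ.target ∩ φ.symm ⁻¹' U ∈ 𝓝 (φ x) := by
    refine inter_mem (φ.open_target.mem_nhds (φ.map_source hxφ)) ?_
    refine (φ.continuousAt_symm (φ.map_source hxφ)).preimage_mem_nhds ?_
    rwa [φ.left_inv hxφ]
  obtain ⟨r, hr, hball⟩ := Metric.mem_nhds_iff.1 hpre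
  have hu : ∀ v, OpenPartialHomeomorph.univBall (φ x) r v ∈ Metric.ball (φ x) r := fun v => by
    rw [← OpenPartialHomeomorph.univBall_target _ hr]
    exact OpenPartialHomeomorph.map_source _ (by simp)
  let ψ := (OpenPartialHomeomorph.univBall (φ x) r).trans φ.symm
  have hψ : ψ.source = univ := by
    ext v
    simpa [ψ] using (hball (hu v)).1
  refine ⟨ψ, ψ.isOpenEmbedding hψ, by simp [ψ, hxφ], ?_, W, hW, fun v => ?_⟩
  · rintro _ ⟨v, rfl⟩
    exact (hball (hu v)).2
  · have h := (hball (hu v)).1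
    show φ.symm (OpenPartialHomeomorph.univBall (φ x) r v) ∈ V ↔ v ∈ W
    rw [hVW _ (φ.map_target h), φ.right_inv h]
    exact OpenPartialHomeomorph.univBall_mem_iff W ((hVW x hxφ).1 hx) hr v

theorem IsClosedSubmanifold.dense_compl {d : ℕ} {V : Set M} (hV : IsClosedSubmanifold m d V)
    (hd : 1 ≤ d) : Dense Vᶜ := by
  intro x
  by_cases hx : x ∈ V
  · obtain ⟨ψ, hψ, rfl, -, W, hW, hVW⟩ := hV.exists_isOpenEmbedding hx univ_mem
    have hWt : W ≠ ⊤ := by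
      rintro rfl
      simp at hW
      omega
    have := mem_closure_image hψ.continuous.continuousAt (Submodule.zero_mem_closure_compl hWt)
    refine closure_mono ?_ this
    rintro _ ⟨v, hv, rfl⟩
    exact fun h => hv ((hVW v).1 h)
  · exact subset_closure hx

theorem ContinuousOn.exists_log_nhds {X : Type*} [TopologicalSpace X] {g : X → ℂ} {x : X}
    (hgx : g x ≠ 0) {U : Set X} (hU : IsOpen U) (hx : x ∈ U) (hg : ContinuousOn g U) :
    ∃ U' ⊆ U, IsOpen U' ∧ x ∈ U' ∧ ∃ h : X → ℂ, ContinuousOn h U' ∧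
      ∀ y ∈ U', Complex.exp (h y) = g y := by
  have hc : ContinuousOn (fun y => g y / g x) U := hg.div_const _
  -- Dividing by `g x` moves the value at `x` to `1`, where the principal branch is continuous.
  refine ⟨U ∩ (fun y => g y / g x) ⁻¹' Complex.slitPlane, inter_subset_left,
    hc.isOpen_inter_preimage hU Complex.isOpen_slitPlane, ⟨hx, ?_⟩,
    fun y => Complex.log (g y / g x) + Complex.log (g x), ?_, ?_⟩
  · simp [hgx]
  · exact ((hc.mono inter_subset_left).clog fun y hy => hy.2).add continuousOn_const
  · intro y hy
    have : g y / g x ≠ 0 := Complex.slitPlane_ne_zero hy.2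
    rw [Complex.exp_add, Complex.exp_log this, Complex.exp_log hgx, div_mul_cancel₀ _ hgx]

/-- A logarithm on the complement of a submanifold of codimension at least two, of a function
without zeros on all of `U`, has limits at the points of the submanifold. -/
theorem IsClosedSubmanifold.exists_tendsto_log {d : ℕ} {V : Set M}
    (hV : IsClosedSubmanifold m d V) (hd : 2 ≤ d) {U : Set M} (hU : IsOpen U) {g f : M → ℂ}
    (hg : ContinuousOn g U) (hne : ∀ y ∈ U, g y ≠ 0) (hf : ContinuousOn f (U \ V))
    (hfg : ∀ y ∈ U \ V, Complex.exp (f y) = g y) {x : M} (hx : x ∈ U) :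
    ∃ c : ℂ, Tendsto f (𝓝[Vᶜ] x) (𝓝 c) ∧ Complex.exp c = g x := by
  suffices h : ∃ c : ℂ, Tendsto f (𝓝[Vᶜ] x) (𝓝 c) by
    obtain ⟨c, hc⟩ := h
    refine ⟨c, hc, ?_⟩
    have : (𝓝[Vᶜ] x).NeBot := mem_closure_iff_nhdsWithin_neBot.1 (hV.dense_compl (by omega) x)
    have h1 : Tendsto (fun y => Complex.exp (f y)) (𝓝[Vᶜ] x) (𝓝 (Complex.exp c)) :=
      (Complex.continuous_exp.tendsto c).comp hc
    have h2 : Tendsto g (𝓝[Vᶜ] x) (𝓝 (g x)) :=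
      (hg.continuousAt (hU.mem_nhds hx)).tendsto.mono_left nhdsWithin_le_nhds
    refine tendsto_nhds_unique (h1.congr' ?_) h2
    filter_upwards [self_mem_nhdsWithin, mem_nhdsWithin_of_mem_nhds (hU.mem_nhds hx)] with y h h'
    exact hfg y ⟨h', h⟩
  by_cases hxV : x ∈ V
  swap
  · exact ⟨f x, (hf.continuousAt ((hU.sdiff hV.1).mem_nhds ⟨hx, hxV⟩)).tendsto.mono_left
      nhdsWithin_le_nhds⟩
  obtain ⟨U', hU'U, hU', hxU', h, hh, hhe⟩ :=
    ContinuousOn.exists_log_nhds (hne x hx) hU hx hg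
  obtain ⟨ψ, hψ, rfl, hψU, W, hW, hVW⟩ := hV.exists_isOpenEmbedding hxV (hU'.mem_nhds hxU')
  have hmaps : MapsTo ψ (Wᶜ : Set _) (U' \ V) := fun v hv =>
    ⟨hψU (mem_range_self v), fun h => hv ((hVW v).1 h)⟩
  have hfr : Module.finrank ℝ W + 2 ≤ Module.finrank ℝ (EuclideanSpace ℝ (Fin m)) := by
    rw [finrank_euclideanSpace_fin]
    omega
  -- Off `V` the given logarithm and the local one `h` differ by a constant, and `h` is continuous
  -- at `ψ 0`.
  obtain ⟨c, -, hc⟩ := (W.isPreconnected_compl_of_finrank hfr).exists_eq_add_of_exp_eq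
    (f₁ := f ∘ ψ) (f₂ := h ∘ ψ)
    ((hf.mono (sdiff_subset_sdiff_left hU'U)).comp hψ.continuous.continuousOn hmaps)
    ((hh.mono sdiff_subset).comp hψ.continuous.continuousOn hmaps)
    (fun v hv => (hfg _ ⟨hU'U (hmaps hv).1, (hmaps hv).2⟩).trans (hhe _ (hmaps hv).1).symm)
  refine ⟨h (ψ 0) + c, ?_⟩
  have h1 : Tendsto (fun y => h y + c) (𝓝[Vᶜ] (ψ 0)) (𝓝 (h (ψ 0) + c)) :=
    ((hh.continuousAt (hU'.mem_nhds hxU')).add_const c).tendsto.mono_left nhdsWithin_le_nhds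
  refine h1.congr' ?_
  filter_upwards [self_mem_nhdsWithin,
    mem_nhdsWithin_of_mem_nhds (hψ.isOpen_range.mem_nhds (mem_range_self 0))] with y hyV hy
  obtain ⟨v, rfl⟩ := hy
  exact (hc v fun hv => hyV ((hVW v).2 hv)).symm

/-- The limit clause is kept so that identities between logarithms off `V` can be carried to points
of `V`. -/
theorem IsClosedSubmanifold.exists_log_extension {d : ℕ} {V : Set M}
    (hV : IsClosedSubmanifold m d V) (hd : 2 ≤ d) {U : Set M} (hU : IsOpen U) {g f : M → ℂ}
    (hg : ContinuousOn g U) (hne : ∀ y ∈ U, g y ≠ 0) (hf : ContinuousOn f (U \ V))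
    (hfg : ∀ y ∈ U \ V, Complex.exp (f y) = g y) :
    ∃ f' : M → ℂ, ContinuousOn f' U ∧ (∀ y ∈ U, Complex.exp (f' y) = g y) ∧
      ∀ y ∈ U, Tendsto f (𝓝[Vᶜ] y) (𝓝 (f' y)) := by
  have hlim := fun y (hy : y ∈ U) => hV.exists_tendsto_log hd hU hg hne hf hfg hy
  have hdense := hV.dense_compl (by omega)
  have hval : ∀ y ∈ U, Tendsto f (𝓝[Vᶜ] y) (𝓝 (extendFrom Vᶜ f y)) := fun y hy =>
    tendsto_extendFrom (let ⟨c, hc, _⟩ := hlim y hy; ⟨c, hc⟩)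
  refine ⟨extendFrom Vᶜ f, continuousOn_extendFrom (fun y _ => hdense y)
    fun y hy => ⟨_, hval y hy⟩, fun y hy => ?_, hval⟩
  obtain ⟨c, hc, hce⟩ := hlim y hy
  rw [extendFrom_eq (hdense y) hc, hce]

/-- `U` varies in the induction: the logarithm is extended across the other submanifolds inside the
open set `U \ V i`, then across `V i`. -/
theorem exists_log_extension_of_finset {ι : Type*} {V : ι → Set M} {d : ι → ℕ}
    (hV : ∀ i, IsClosedSubmanifold m (d i) (V i)) (hd : ∀ i, 2 ≤ d i) {g : M → ℂ}
    (s : Finset ι) : ∀ {U : Set M}, IsOpen U → ContinuousOn g U → (∀ y ∈ U, g y ≠ 0) →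
      ∀ f : M → ℂ, ContinuousOn f (U \ ⋃ i ∈ s, V i) →
      (∀ y ∈ U \ ⋃ i ∈ s, V i, Complex.exp (f y) = g y) →
      ∃ f' : M → ℂ, ContinuousOn f' U ∧ ∀ y ∈ U, Complex.exp (f' y) = g y := by
  classical
  induction s using Finset.induction_on with
  | empty => exact fun _ _ _ f hf hfg => ⟨f, by simpa using hf, by simpa using hfg⟩
  | insert i s _ ih =>
    intro U hU hg hne f hf hfg
    have hset : U \ ⋃ j ∈ insert i s, V j = (U \ V i) \ ⋃ j ∈ s, V j := by
      rw [Finset.set_biUnion_insert, sdiff_sdiff]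
    rw [hset] at hf hfg
    obtain ⟨f', hf', hfg'⟩ := ih (hU.sdiff (hV i).1) (hg.mono sdiff_subset)
      (fun y hy => hne y hy.1) f hf hfg
    obtain ⟨f'', h1, h2, -⟩ := (hV i).exists_log_extension (hd i) hU hg hne hf' hfg'
    exact ⟨f'', h1, h2⟩

end

/-! ### Smoothness of complex-valued functions -/

section ComplexValued

variable {E H N : Type*} [NormedAddCommGroup E] [NormedSpace ℝ E] [TopologicalSpace H]
  {I : ModelWithCorners ℝ E H} [TopologicalSpace N] [ChartedSpace H N] {n : ℕ∞} {f g : N → ℂ}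
  {s : Set N} {x : N}

theorem ContMDiffWithinAt.complex_mul (hf : ContMDiffWithinAt I 𝓘(ℝ, ℂ) n f s x)
    (hg : ContMDiffWithinAt I 𝓘(ℝ, ℂ) n g s x) :
    ContMDiffWithinAt I 𝓘(ℝ, ℂ) n (fun y => f y * g y) s x :=
  ((contDiff_mul (𝕜 := ℝ) (𝔸 := ℂ)).contDiffAt.contMDiffAt (x := (f x, g x))).comp_contMDiffWithinAt
    x (hf.prodMk_space hg)

theorem ContMDiffOn.complex_mul (hf : ContMDiffOn I 𝓘(ℝ, ℂ) n f s)
    (hg : ContMDiffOn I 𝓘(ℝ, ℂ) n g s) : ContMDiffOn I 𝓘(ℝ, ℂ) n (fun y => f y * g y) s :=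
  fun y hy => (hf y hy).complex_mul (hg y hy)

theorem ContMDiffWithinAt.complex_inv (hf : ContMDiffWithinAt I 𝓘(ℝ, ℂ) n f s x) (h : f x ≠ 0) :
    ContMDiffWithinAt I 𝓘(ℝ, ℂ) n (fun y => (f y)⁻¹) s x :=
  (contDiffAt_inv ℝ h).contMDiffAt.comp_contMDiffWithinAt x hf

theorem ContMDiffWithinAt.complex_div (hf : ContMDiffWithinAt I 𝓘(ℝ, ℂ) n f s x)
    (hg : ContMDiffWithinAt I 𝓘(ℝ, ℂ) n g s x) (h : g x ≠ 0) :
    ContMDiffWithinAt I 𝓘(ℝ, ℂ) n (fun y => f y / g y) s x := by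
  simpa only [div_eq_mul_inv] using hf.complex_mul (hg.complex_inv h)

theorem ContMDiffOn.complex_exp (hf : ContMDiffOn I 𝓘(ℝ, ℂ) n f s) :
    ContMDiffOn I 𝓘(ℝ, ℂ) n (fun y => Complex.exp (f y)) s := fun x hx =>
  (Complex.contDiff_exp (𝕜 := ℝ)).contDiffAt.contMDiffAt.comp_contMDiffWithinAt x (hf x hx)

/-- A continuous logarithm of a `C^n` function is `C^n`. -/
theorem ContinuousOn.contMDiffOn_log (hf : ContinuousOn f s) (hg : ContMDiffOn I 𝓘(ℝ, ℂ) n g s)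
    (hfg : ∀ y ∈ s, Complex.exp (f y) = g y) : ContMDiffOn I 𝓘(ℝ, ℂ) n f s := by
  intro x hx
  have hx0 : g x ≠ 0 := hfg x hx ▸ Complex.exp_ne_zero _
  have h1 : ContMDiffWithinAt I 𝓘(ℝ, ℂ) n (fun y => Complex.log (g y / g x) + f x) s x := by
    refine ContMDiffWithinAt.add ?_ contMDiffWithinAt_const
    have hq := (hg x hx).complex_div contMDiffWithinAt_const hx0
    refine ContMDiffAt.comp_contMDiffWithinAt (g := Complex.log) x ?_ hq
    refine ((Complex.contDiffAt_log ?_).restrict_scalars ℝ).contMDiffAt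
    simp [hx0]
  refine h1.congr_of_eventuallyEq ?_ (by simp [hx0])
  -- Within this strip the principal branch inverts `exp`, so `f` is a smooth local formula in `g`.
  have him : ∀ᶠ y in 𝓝[s] x, |(f y - f x).im| < Real.pi := by
    have : Tendsto (fun y => |(f y - f x).im|) (𝓝[s] x) (𝓝 |(f x - f x).im|) :=
      (Complex.continuous_im.tendsto _ |>.comp ((hf x hx).sub_const _)).abs
    refine this.eventually_lt_const ?_
    simpa using Real.pi_pos
  filter_upwards [him, self_mem_nhdsWithin] with y hy hys
  rw [← hfg x hx, ← hfg y hys, ← Complex.exp_sub,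
    Complex.log_exp (abs_lt.1 hy).1 (abs_lt.1 hy).2.le, sub_add_cancel]

end ComplexValued

/-! ### Ratios of trivializations -/

section

variable {m : ℕ} {M : Type*} [TopologicalSpace M] [ChartedSpace (EuclideanSpace ℝ (Fin m)) M]
  {L : M → Type*} [TopologicalSpace (TotalSpace ℂ L)] [∀ x, NormedAddCommGroup (L x)]
  [∀ x, InnerProductSpace ℂ (L x)] [FiberBundle ℂ L] [VectorBundle ℂ ℂ L]
  {r : ℕ∞} {U : Set M} {Φ Φ' : TotalSpace ℂ L → ℂ}

theorem IsTrivializationOn.ne_zero (h : IsTrivializationOn m r U Φ) {x : M} (hx : x ∈ U) {v : L x}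
    (hv : v ≠ 0) : Φ ⟨x, v⟩ ≠ 0 := by
  obtain ⟨e, he⟩ := h.2 x hx
  simpa [he] using hv

/-- Linear functionals on a one-dimensional fiber are proportional. -/
theorem IsTrivializationOn.mul_comm_apply (h : IsTrivializationOn m r U Φ)
    (h' : IsTrivializationOn m r U Φ') {x : M} (hx : x ∈ U) (v w : L x) :
    Φ' ⟨x, v⟩ * Φ ⟨x, w⟩ = Φ' ⟨x, w⟩ * Φ ⟨x, v⟩ := by
  obtain ⟨e, he⟩ := h.2 x hx
  obtain ⟨e', he'⟩ := h'.2 x hx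
  have hsm : ∀ u : L x, u = e u • e.symm 1 := fun u => e.injective (by simp)
  have key : ∀ u : L x, e' u = e u * e' (e.symm 1) := fun u => by
    conv_lhs => rw [hsm u]
    simp
  rw [he, he, he', he', key v, key w]
  ring

/-- The function by which one trivialization of a line bundle differs from another. -/
noncomputable def trivializationRatio (Φ' Φ : TotalSpace ℂ L → ℂ) (x : M) : ℂ :=
  Φ' ⟨x, (trivializationAt ℂ L x).symm x 1⟩ / Φ ⟨x, (trivializationAt ℂ L x).symm x 1⟩

theorem trivialization_symm_one_ne_zero (e : Trivialization ℂ (π ℂ L))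
    [MemTrivializationAtlas e] {x : M} (hx : x ∈ e.baseSet) : e.symm x 1 ≠ 0 :=
  fun h => one_ne_zero ((e.linearEquivAt ℂ x hx).symm.map_eq_zero_iff.1 h)

theorem trivializationRatio_eq_div (h : IsTrivializationOn m r U Φ)
    (h' : IsTrivializationOn m r U Φ') {x : M} (hx : x ∈ U) {v : L x} (hv : v ≠ 0) :
    trivializationRatio Φ' Φ x = Φ' ⟨x, v⟩ / Φ ⟨x, v⟩ := by
  have h1 := trivialization_symm_one_ne_zero (trivializationAt ℂ L x)
    (mem_baseSet_trivializationAt ℂ L x)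
  rw [trivializationRatio, div_eq_div_iff (h.ne_zero hx h1) (h.ne_zero hx hv)]
  exact h.mul_comm_apply h' hx _ _

theorem trivializationRatio_ne_zero (h : IsTrivializationOn m r U Φ)
    (h' : IsTrivializationOn m r U Φ') {x : M} (hx : x ∈ U) : trivializationRatio Φ' Φ x ≠ 0 := by
  have h1 := trivialization_symm_one_ne_zero (trivializationAt ℂ L x)
    (mem_baseSet_trivializationAt ℂ L x)
  exact div_ne_zero (h'.ne_zero hx h1) (h.ne_zero hx h1)

theorem eq_trivializationRatio_mul (h : IsTrivializationOn m r U Φ)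
    (h' : IsTrivializationOn m r U Φ') (p : TotalSpace ℂ L) (hp : p.proj ∈ U) :
    Φ' p = trivializationRatio Φ' Φ p.proj * Φ p := by
  have h1 := trivialization_symm_one_ne_zero (trivializationAt ℂ L p.proj)
    (mem_baseSet_trivializationAt ℂ L p.proj)
  rw [trivializationRatio, div_mul_eq_mul_div, eq_div_iff (h.ne_zero hp h1)]
  exact h.mul_comm_apply h' hp p.2 _

theorem trivializationRatio_eq_of_eq_mul (h : IsTrivializationOn m r U Φ) {x : M} (hx : x ∈ U)
    {c : ℂ} (hc : ∀ v : L x, Φ' ⟨x, v⟩ = c * Φ ⟨x, v⟩) : trivializationRatio Φ' Φ x = c := by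
  have h1 := trivialization_symm_one_ne_zero (trivializationAt ℂ L x)
    (mem_baseSet_trivializationAt ℂ L x)
  rw [trivializationRatio, hc, mul_div_cancel_right₀ _ (h.ne_zero hx h1)]

theorem IsTrivializationOn.mono (h : IsTrivializationOn m r U Φ) {U' : Set M} (hU : U' ⊆ U) :
    IsTrivializationOn m r U' Φ :=
  ⟨h.1.mono (preimage_mono hU), fun x hx => h.2 x (hU hx)⟩

theorem IsTrivializationOn.congr (h : IsTrivializationOn m r U Φ)
    (he : ∀ p : TotalSpace ℂ L, p.proj ∈ U → Φ' p = Φ p) : IsTrivializationOn m r U Φ' :=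
  ⟨h.1.congr fun p hp => he p hp, fun x hx =>
    let ⟨e, h'⟩ := h.2 x hx
    ⟨e, fun v => (he ⟨x, v⟩ hx).trans (h' v)⟩⟩

theorem isTrivializationOn_of_local
    (h : ∀ x ∈ U, ∃ N, IsOpen N ∧ x ∈ N ∧ IsTrivializationOn m r N Φ) :
    IsTrivializationOn m r U Φ := by
  refine ⟨fun p hp => ?_, fun x hx => ?_⟩
  · obtain ⟨N, hN, hxN, hΦ⟩ := h p.proj hp
    have : π ℂ L ⁻¹' N ∈ 𝓝 p := (hN.preimage (FiberBundle.continuous_proj ℂ L)).mem_nhds hxN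
    exact (hΦ.1.contMDiffAt this).contMDiffWithinAt
  · obtain ⟨N, hN, hxN, hΦ⟩ := h x hx
    exact hΦ.2 x hxN

theorem IsTrivializationOn.mul (h : IsTrivializationOn m r U Φ) {q : M → ℂ}
    (hq : ContMDiffOn (𝓡 m) 𝓘(ℝ, ℂ) r q U) (hne : ∀ x ∈ U, q x ≠ 0) :
    IsTrivializationOn m r U (fun p => q p.proj * Φ p) := by
  refine ⟨(hq.comp (contMDiffOn_proj L) fun p hp => hp).complex_mul h.1, fun x hx => ?_⟩
  obtain ⟨e, he⟩ := h.2 x hx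
  exact ⟨e.trans (LinearEquiv.smulOfNeZero ℂ ℂ (q x) (hne x hx)), fun v => by simp [he]⟩

theorem IsTrivializationOn.exp_mul (h : IsTrivializationOn m r U Φ) {f : M → ℂ}
    (hf : ContMDiffOn (𝓡 m) 𝓘(ℝ, ℂ) r f U) :
    IsTrivializationOn m r U (fun p => Complex.exp (f p.proj) * Φ p) :=
  h.mul hf.complex_exp fun _ _ => Complex.exp_ne_zero _

theorem TrivializationsHomotopicOn.of_eq_exp_mul (h : IsTrivializationOn m r U Φ) {f : M → ℂ}
    (hf : ContMDiffOn (𝓡 m) 𝓘(ℝ, ℂ) r f U)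
    (he : ∀ p : TotalSpace ℂ L, p.proj ∈ U → Φ' p = Complex.exp (f p.proj) * Φ p) :
    TrivializationsHomotopicOn m r U Φ Φ' := by
  refine ⟨fun t p => Complex.exp ((t : ℂ) * f p.proj) * Φ p, ?_, fun t _ => ?_, fun p _ => by simp,
    fun p hp => by simpa using (he p hp).symm⟩
  · refine ContMDiffOn.complex_mul (ContMDiffOn.complex_exp (ContMDiffOn.complex_mul ?_ ?_)) ?_
    · exact (Complex.ofRealCLM.contMDiff.comp contMDiff_fst).contMDiffOn
    · exact hf.comp ((contMDiff_proj L).comp contMDiff_snd).contMDiffOn fun p hp => hp.2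
    · exact h.1.comp contMDiff_snd.contMDiffOn fun p hp => hp.2
  · exact h.exp_mul (contMDiffOn_const.complex_mul hf)

section

variable [ContMDiffVectorBundle ∞ ℂ L (𝓡 m)]

theorem isTrivializationOn_snd (e : Trivialization ℂ (π ℂ L)) [MemTrivializationAtlas e] :
    IsTrivializationOn m r e.baseSet (fun p => (e p).2) := by
  refine ⟨?_, fun x hx => ⟨e.linearEquivAt ℂ x hx, fun v => rfl⟩⟩
  have : ContMDiffVectorBundle r ℂ L (𝓡 m) := .of_le (mod_cast le_top : (r : ℕ∞ω) ≤ ∞)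
  rw [← e.source_eq]
  exact contMDiff_snd.comp_contMDiffOn (e.contMDiffOn (IB := 𝓡 m) (n := r))

theorem contMDiffOn_symm_one (e : Trivialization ℂ (π ℂ L)) [MemTrivializationAtlas e] :
    ContMDiffOn (𝓡 m) ((𝓡 m).prod 𝓘(ℝ, ℂ)) r
      (fun x => (⟨x, e.symm x 1⟩ : TotalSpace ℂ L)) e.baseSet := by
  have : ContMDiffVectorBundle r ℂ L (𝓡 m) := .of_le (mod_cast le_top : (r : ℕ∞ω) ≤ ∞)
  have h := (e.contMDiffOn_symm (IB := 𝓡 m) (n := r)).comp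
    (contMDiffOn_id.prodMk contMDiffOn_const : ContMDiffOn (𝓡 m) ((𝓡 m).prod 𝓘(ℝ, ℂ)) r
      (fun x => (x, (1 : ℂ))) e.baseSet) fun x hx => by simpa [e.mem_target] using hx
  exact h.congr fun x hx => e.mk_symm hx 1

/-- The vector used to define the ratio comes from a trivialization that changes with the point.
Since any nonzero vector gives the same ratio, it may be computed near `x` on one smooth local
frame. -/
theorem contMDiffOn_trivializationRatio (h : IsTrivializationOn m r U Φ)
    (h' : IsTrivializationOn m r U Φ') :
    ContMDiffOn (𝓡 m) 𝓘(ℝ, ℂ) r (trivializationRatio Φ' Φ) U := by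
  intro x hx
  let e := trivializationAt ℂ L x
  have hxe : x ∈ e.baseSet := mem_baseSet_trivializationAt ℂ L x
  have hs := ((contMDiffOn_symm_one (m := m) (r := r) e).contMDiffAt
    (e.open_baseSet.mem_nhds hxe)).contMDiffWithinAt (s := U)
  have hm : MapsTo (fun x => (⟨x, e.symm x 1⟩ : TotalSpace ℂ L)) U (π ℂ L ⁻¹' U) := fun y hy => hy
  have hq := ContMDiffWithinAt.complex_div ((h'.1 _ (hm hx)).comp x hs hm)
    ((h.1 _ (hm hx)).comp x hs hm) (h.ne_zero hx (trivialization_symm_one_ne_zero e hxe))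
  refine hq.congr_of_eventuallyEq ?_
    (trivializationRatio_eq_div h h' hx (trivialization_symm_one_ne_zero e hxe))
  filter_upwards [self_mem_nhdsWithin, mem_nhdsWithin_of_mem_nhds (e.open_baseSet.mem_nhds hxe)]
    with y hy hye
  exact trivializationRatio_eq_div h h' hy (trivialization_symm_one_ne_zero e hye)

/-- The ratios of `F t` to `Φ` form a homotopy from `1` through nowhere zero functions, so the
homotopy lifting lemma applies. -/
theorem TrivializationsHomotopicOn.exists_log (h : IsTrivializationOn m r U Φ)
    (hh : TrivializationsHomotopicOn m r U Φ Φ') :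
    ∃ f : M → ℂ, ContinuousOn f U ∧ ∀ x ∈ U, Complex.exp (f x) = trivializationRatio Φ' Φ x := by
  obtain ⟨F, hF, hFt, hF0, hF1⟩ := hh
  have hcont : ContinuousOn (fun p : ℝ × M => trivializationRatio (F p.1) Φ p.2)
      (Icc 0 1 ×ˢ U) := by
    rintro ⟨t, x⟩ ⟨ht, hx⟩
    let e := trivializationAt ℂ L x
    have hxe : x ∈ e.baseSet := mem_baseSet_trivializationAt ℂ L x
    let s : M → TotalSpace ℂ L := fun x => ⟨x, e.symm x 1⟩
    have hs : ContinuousAt s x := (contMDiffOn_symm_one (m := m) (r := 0) e).continuousOn.continuousAt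
      (e.open_baseSet.mem_nhds hxe)
    have hs2 : ContinuousWithinAt (fun p : ℝ × M => s p.2) (Icc 0 1 ×ˢ U) (t, x) :=
      (hs.comp (f := Prod.snd) (x := (t, x)) continuousAt_snd).continuousWithinAt
    have h1 : ContinuousWithinAt (fun p : ℝ × M => F p.1 (s p.2)) (Icc 0 1 ×ˢ U) (t, x) :=
      ContinuousWithinAt.comp (f := fun p : ℝ × M => (p.1, s p.2))
        (g := fun p : ℝ × TotalSpace ℂ L => F p.1 p.2) (t := Icc 0 1 ×ˢ (π ℂ L ⁻¹' U))
        (hF.continuousOn (t, s x) ⟨ht, hx⟩) (continuousWithinAt_fst.prodMk hs2)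
        fun p hp => ⟨hp.1, hp.2⟩
    have h2 : ContinuousWithinAt (fun p : ℝ × M => Φ (s p.2)) (Icc 0 1 ×ˢ U) (t, x) :=
      ContinuousWithinAt.comp (f := fun p : ℝ × M => s p.2)
        (h.1.continuousOn (s x) hx) hs2 fun p hp => hp.2
    have h3 := h1.div h2 (h.ne_zero hx (trivialization_symm_one_ne_zero e hxe))
    refine h3.congr_of_eventuallyEq ?_
      (trivializationRatio_eq_div h (hFt t ht) hx (trivialization_symm_one_ne_zero e hxe))
    filter_upwards [self_mem_nhdsWithin, mem_nhdsWithin_of_mem_nhds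
      (continuousAt_snd.preimage_mem_nhds (e.open_baseSet.mem_nhds hxe))] with p hp hpe
    exact trivializationRatio_eq_div h (hFt p.1 hp.1) hp.2 (trivialization_symm_one_ne_zero e hpe)
  obtain ⟨f, hf, hfe⟩ := ContinuousOn.exists_log_of_homotopy hcont
    (fun t ht x hx => trivializationRatio_ne_zero h (hFt t ht) hx)
    (fun x hx => trivializationRatio_eq_of_eq_mul h hx fun v => by
      rw [one_mul]; exact hF0 ⟨x, v⟩ hx)
  refine ⟨f, hf, fun x hx => ?_⟩
  rw [hfe x hx]
  refine trivializationRatio_eq_of_eq_mul h hx fun v => ?_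
  rw [hF1 ⟨x, v⟩ hx]
  exact eq_trivializationRatio_mul h
    ((hFt 1 (by simp)).congr fun p hp => (hF1 p hp).symm) ⟨x, v⟩ hx

end

end

/-- Smooth additive cocycles on a manifold are coboundaries. -/
theorem exists_contMDiffOn_sub_eq_of_cocycle {E H N : Type*} [NormedAddCommGroup E]
    [NormedSpace ℝ E] [FiniteDimensional ℝ E] [TopologicalSpace H] (I : ModelWithCorners ℝ E H)
    [TopologicalSpace N] [ChartedSpace H N] [IsManifold I ∞ N] [T2Space N] [SigmaCompactSpace N]
    {ι : Type*} {B : ι → Set N} (hB : ∀ i, IsOpen (B i)) (hcov : ∀ y, ∃ i, y ∈ B i)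
    {a : ι → ι → N → ℂ} (ha : ∀ i j, ContMDiffOn I 𝓘(ℝ, ℂ) ∞ (a i j) (B i ∩ B j))
    (hc : ∀ i j k, ∀ y ∈ B i ∩ B j ∩ B k, a i k y - a i j y = a j k y) :
    ∃ b : ι → N → ℂ, (∀ i, ContMDiffOn I 𝓘(ℝ, ℂ) ∞ (b i) (B i)) ∧
      ∀ i j, ∀ y ∈ B i ∩ B j, b j y - b i y = a i j y := by
  obtain ⟨ρ, hρ⟩ := SmoothPartitionOfUnity.exists_isSubordinate I isClosed_univ B hB
    fun y _ => mem_iUnion.2 (hcov y)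
  -- Averaging the cocycle over its first index: as the weights sum to one, the cocycle identity
  -- makes the averages differ by `a j k`.
  refine ⟨fun j y => ∑ᶠ i, ρ i y • a i j y, fun j y hy => ?_, fun j k y hy => ?_⟩
  · refine (ρ.contMDiffAt_finsum fun i hi => ?_).contMDiffWithinAt
    exact (ha i j).contMDiffAt (((hB i).inter (hB j)).mem_nhds ⟨hρ i hi, hy⟩)
  · have hfin : ∀ j, (Function.support fun i => ρ i y • a i j y).Finite := fun j => by
      refine (ρ.locallyFinite.point_finite y).subset fun i hi => ?_
      exact fun h => hi (by simp [h])
    show ∑ᶠ i, ρ i y • a i k y - ∑ᶠ i, ρ i y • a i j y = a j k y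
    rw [← finsum_sub_distrib (hfin k) (hfin j)]
    have : ∀ i, ρ i y • a i k y - ρ i y • a i j y = ρ i y • a j k y := fun i => by
      by_cases h : ρ i y = 0
      · simp [h]
      · rw [← smul_sub, hc i j k y ⟨⟨hρ i (subset_tsupport _ h), hy.1⟩, hy.2⟩]
    simp_rw [this]
    rw [← finsum_smul, ρ.sum_eq_one (mem_univ y), one_smul]

/-! ### Extending trivializations across codimension three -/

section

variable {m : ℕ} {M : Type*} [TopologicalSpace M] [ChartedSpace (EuclideanSpace ℝ (Fin m)) M]

theorem IsOpen.exists_contMDiffOn_sub_eq_of_cocycle [T2Space M] [SecondCountableTopology M]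
    [IsManifold (𝓡 m) ∞ M] {U : Set M} (hU : IsOpen U) {ι : Type*} {B : ι → Set M}
    (hB : ∀ i, IsOpen (B i)) (hBU : ∀ i, B i ⊆ U) (hcov : ∀ y ∈ U, ∃ i, y ∈ B i)
    {a : ι → ι → M → ℂ} (ha : ∀ i j, ContMDiffOn (𝓡 m) 𝓘(ℝ, ℂ) ∞ (a i j) (B i ∩ B j))
    (hc : ∀ i j k, ∀ y ∈ B i ∩ B j ∩ B k, a i k y - a i j y = a j k y) :
    ∃ b : ι → M → ℂ, (∀ i, ContMDiffOn (𝓡 m) 𝓘(ℝ, ℂ) ∞ (b i) (B i)) ∧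
      ∀ i j, ∀ y ∈ B i ∩ B j, b j y - b i y = a i j y := by
  classical
  -- The open set is treated as a manifold in its own right; the resulting functions get the
  -- harmless value `0` off `U`.
  let O : TopologicalSpace.Opens M := ⟨U, hU⟩
  have : LocallyCompactSpace O := ChartedSpace.locallyCompactSpace (EuclideanSpace ℝ (Fin m)) O
  obtain ⟨b, hb, hba⟩ := _root_.exists_contMDiffOn_sub_eq_of_cocycle (N := O) (𝓡 m)
    (B := fun i => (Subtype.val : O → M) ⁻¹' B i) (a := fun i j y => a i j y)
    (fun i => (hB i).preimage continuous_subtype_val) (fun y => hcov y y.2)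
    (fun i j => (ha i j).comp contMDiff_subtype_val.contMDiffOn fun y hy => hy)
    (fun i j k y hy => hc i j k y hy)
  refine ⟨fun i y => if h : y ∈ U then b i ⟨y, h⟩ else 0, fun i y hy => ?_, fun i j y hy => ?_⟩
  · refine ContMDiffAt.contMDiffWithinAt ?_
    refine (contMDiffAt_subtype_iff (U := O) (x := ⟨y, hBU i hy⟩)).1 ?_
    refine ((hb i).contMDiffAt
      (((hB i).preimage continuous_subtype_val).mem_nhds hy)).congr_of_eventuallyEq ?_
    exact Eventually.of_forall fun z => dif_pos z.2
  · have h := hBU i hy.1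
    simpa [h] using hba i j ⟨y, h⟩ hy

variable {L : M → Type*} [TopologicalSpace (TotalSpace ℂ L)] [∀ x, NormedAddCommGroup (L x)]
  [∀ x, InnerProductSpace ℂ (L x)] [FiberBundle ℂ L] [VectorBundle ℂ ℂ L]
  [ContMDiffVectorBundle ∞ ℂ L (𝓡 m)] {U V : Set M} {d : ℕ} {Φ : TotalSpace ℂ L → ℂ}

/-- Away from `V` take `φ = Φ` and `f = 0`. At a point of `V`, compare `Φ` with a bundle
trivialization in the linear model. -/
theorem IsClosedSubmanifold.exists_local_log (hV : IsClosedSubmanifold m d V) (hd : 3 ≤ d)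
    (hU : IsOpen U) (hΦ : IsTrivializationOn m ⊤ (U \ V) Φ) {x : M} (hx : x ∈ U) :
    ∃ B ⊆ U, IsOpen B ∧ x ∈ B ∧ ∃ φ : TotalSpace ℂ L → ℂ, IsTrivializationOn m ⊤ B φ ∧
      ∃ f : M → ℂ, ContinuousOn f (B \ V) ∧ ∀ p : TotalSpace ℂ L, p.proj ∈ B \ V →
        Φ p = Complex.exp (f p.proj) * φ p := by
  by_cases hxV : x ∈ V
  swap
  · exact ⟨U \ V, sdiff_subset, hU.sdiff hV.1, ⟨hx, hxV⟩, Φ, hΦ, 0, continuousOn_const,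
      fun p _ => by simp⟩
  let e := trivializationAt ℂ L x
  obtain ⟨ψ, hψ, rfl, hψU, W, hW, hVW⟩ := hV.exists_isOpenEmbedding hxV
    ((hU.inter e.open_baseSet).mem_nhds ⟨hx, mem_baseSet_trivializationAt ℂ L x⟩)
  have hφ : IsTrivializationOn m ⊤ (range ψ) (fun p => (e p).2) :=
    (isTrivializationOn_snd e).mono (hψU.trans inter_subset_right)
  have hφV : IsTrivializationOn m ⊤ (range ψ \ V) (fun p => (e p).2) := hφ.mono sdiff_subset
  have hΦV : IsTrivializationOn m ⊤ (range ψ \ V) Φ :=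
    hΦ.mono (sdiff_subset_sdiff_left (hψU.trans inter_subset_left))
  have hmaps : MapsTo ψ (Wᶜ : Set _) (range ψ \ V) := fun v hv =>
    ⟨mem_range_self v, fun h => hv ((hVW v).1 h)⟩
  obtain ⟨f, hf, hfe⟩ := W.exists_continuousOn_log_compl
    (by rw [finrank_euclideanSpace_fin]; omega)
    ((contMDiffOn_trivializationRatio hφV hΦV).continuousOn.comp hψ.continuous.continuousOn hmaps)
    (fun v hv => trivializationRatio_ne_zero hφV hΦV (hmaps hv))
  have hinv : ∀ v, Function.invFun ψ (ψ v) = v := Function.leftInverse_invFun hψ.injective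
  have hWc : IsClosed (W : Set (EuclideanSpace ℝ (Fin m))) := W.closed_of_finiteDimensional
  refine ⟨range ψ, hψU.trans inter_subset_left, hψ.isOpen_range, mem_range_self 0, _, hφ,
    f ∘ Function.invFun ψ, ?_, ?_⟩
  · rintro _ ⟨⟨v, rfl⟩, hv⟩
    refine (hψ.continuousAt_iff.1 ?_).continuousWithinAt
    have : (f ∘ Function.invFun ψ) ∘ ψ = f := funext fun v => congrArg f (hinv v)
    rw [this]
    exact hf.continuousAt (hWc.isOpen_compl.mem_nhds fun h => hv ((hVW v).2 h))
  · intro p hp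
    rw [eq_trivializationRatio_mul hφV hΦV p hp]
    obtain ⟨v, hv⟩ := hp.1
    rw [Function.comp, ← hv, hinv, hfe v fun h => hp.2 (hv ▸ (hVW v).2 h)]
    rfl

theorem IsClosedSubmanifold.exists_trivialization_extension [T2Space M]
    [SecondCountableTopology M] [IsManifold (𝓡 m) ∞ M] (hV : IsClosedSubmanifold m d V)
    (hd : 3 ≤ d) (hU : IsOpen U) (hΦ : IsTrivializationOn m ⊤ (U \ V) Φ) :
    ∃ Ψ : TotalSpace ℂ L → ℂ, IsTrivializationOn m ⊤ U Ψ ∧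
      ∃ u : M → ℂ, ContMDiffOn (𝓡 m) 𝓘(ℝ, ℂ) ∞ u (U \ V) ∧
        ∀ p : TotalSpace ℂ L, p.proj ∈ U \ V → Φ p = Complex.exp (u p.proj) * Ψ p := by
  classical
  have hloc := fun x : U => hV.exists_local_log hd hU hΦ x.2
  choose B hBU hB hxB φ hφ f hf hΦf using hloc
  have hne : ∀ x : M, (𝓝[Vᶜ] x).NeBot := fun x =>
    mem_closure_iff_nhdsWithin_neBot.1 (hV.dense_compl (by omega) x)
  have hφi : ∀ i j, IsTrivializationOn m ⊤ (B i ∩ B j) (φ i) := fun i j =>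
    (hφ i).mono inter_subset_left
  have hφj : ∀ i j, IsTrivializationOn m ⊤ (B i ∩ B j) (φ j) := fun i j =>
    (hφ j).mono inter_subset_right
  have hfs : ∀ i, ContMDiffOn (𝓡 m) 𝓘(ℝ, ℂ) ∞ (f i) (B i \ V) := fun i => by
    have h1 := (hφ i).mono (sdiff_subset (s := B i) (t := V))
    have h2 := hΦ.mono (sdiff_subset_sdiff_left (t := V) (hBU i))
    refine (hf i).contMDiffOn_log (contMDiffOn_trivializationRatio h1 h2) fun y hy => ?_
    exact (trivializationRatio_eq_of_eq_mul h1 hy fun v => hΦf i ⟨y, v⟩ hy).symm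
  -- The ratio `φ j / φ i` is nowhere zero on the whole overlap, including `V`, so its logarithm `f
  -- i - f j` extends.
  have hext : ∀ i j, ∃ a : M → ℂ, ContinuousOn a (B i ∩ B j) ∧
      (∀ y ∈ B i ∩ B j, Complex.exp (a y) = trivializationRatio (φ j) (φ i) y) ∧
      ∀ y ∈ B i ∩ B j, Tendsto (fun z => f i z - f j z) (𝓝[Vᶜ] y) (𝓝 (a y)) := fun i j => by
    refine hV.exists_log_extension (by omega) ((hB i).inter (hB j))
      (contMDiffOn_trivializationRatio (hφi i j) (hφj i j)).continuousOn
      (fun y hy => trivializationRatio_ne_zero (hφi i j) (hφj i j) hy)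
      (((hf i).mono (sdiff_subset_sdiff_left inter_subset_left)).sub
        ((hf j).mono (sdiff_subset_sdiff_left inter_subset_right))) fun y hy => ?_
    refine (trivializationRatio_eq_of_eq_mul (hφi i j) hy.1 fun v => ?_).symm
    have h1 := hΦf i ⟨y, v⟩ ⟨hy.1.1, hy.2⟩
    have h2 := hΦf j ⟨y, v⟩ ⟨hy.1.2, hy.2⟩
    rw [Complex.exp_sub, div_mul_eq_mul_div, eq_div_iff (Complex.exp_ne_zero _), mul_comm]
    exact h2.symm.trans h1
  choose a hac hae hat using hext
  have hlim : ∀ i j, ∀ y ∈ (B i ∩ B j) \ V, a i j y = f i y - f j y := fun i j y hy => by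
    have : ContinuousAt (fun z => f i z - f j z) y :=
      ((hf i).continuousAt (((hB i).sdiff hV.1).mem_nhds ⟨hy.1.1, hy.2⟩)).sub
        ((hf j).continuousAt (((hB j).sdiff hV.1).mem_nhds ⟨hy.1.2, hy.2⟩))
    have := hne y
    exact tendsto_nhds_unique (hat i j y hy.1) (ContinuousAt.tendsto ‹_› |>.mono_left
      nhdsWithin_le_nhds)
  -- The cocycle identity is trivial for the differences `f i - f j` and passes to the limit on `V`,
  -- as `Vᶜ` is dense.
  obtain ⟨b, hb, hba⟩ := hU.exists_contMDiffOn_sub_eq_of_cocycle hB hBU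
    (fun y hy => ⟨⟨y, hy⟩, hxB _⟩)
    (fun i j => (hac i j).contMDiffOn_log
      (contMDiffOn_trivializationRatio (hφi i j) (hφj i j)) (hae i j))
    (fun i j k y hy => by
      have := hne y
      refine tendsto_nhds_unique ((hat i k y ⟨hy.1.1, hy.2⟩).sub (hat i j y hy.1)) ?_
      simpa using hat j k y ⟨hy.1.2, hy.2⟩)
  have hwd : ∀ i j, ∀ p : TotalSpace ℂ L, p.proj ∈ B i ∩ B j →
      Complex.exp (-b j p.proj) * φ j p = Complex.exp (-b i p.proj) * φ i p := by
    intro i j p hp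
    rw [eq_trivializationRatio_mul (hφi i j) (hφj i j) p hp, ← hae i j _ hp, ← hba i j _ hp,
      ← mul_assoc, ← Complex.exp_add]
    congr 2
    ring
  let Ψ : TotalSpace ℂ L → ℂ := fun p =>
    if h : p.proj ∈ U then Complex.exp (-b ⟨p.proj, h⟩ p.proj) * φ ⟨p.proj, h⟩ p else 0
  have hΨ : ∀ i (p : TotalSpace ℂ L), p.proj ∈ B i →
      Ψ p = Complex.exp (-b i p.proj) * φ i p := fun i p hp => by
    have h := hBU i hp
    simp only [Ψ, dif_pos h]
    exact hwd i ⟨p.proj, h⟩ p ⟨hp, hxB ⟨p.proj, h⟩⟩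
  -- Off `V`, `b j - b i = f i - f j`, so `b i + f i` does not depend on `i`.
  let u : M → ℂ := fun y => if h : y ∈ U then b ⟨y, h⟩ y + f ⟨y, h⟩ y else 0
  have hu : ∀ i, ∀ y ∈ B i \ V, u y = b i y + f i y := fun i y hy => by
    have h := hBU i hy.1
    simp only [u, dif_pos h]
    have hm : y ∈ B i ∩ B ⟨y, h⟩ := ⟨hy.1, hxB ⟨y, h⟩⟩
    have h1 := hba i ⟨y, h⟩ y hm
    rw [hlim i ⟨y, h⟩ y ⟨hm, hy.2⟩] at h1
    linear_combination h1
  refine ⟨Ψ, isTrivializationOn_of_local fun x hx => ⟨B ⟨x, hx⟩, hB _, hxB ⟨x, hx⟩, ?_⟩, u, ?_, ?_⟩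
  · exact ((hφ ⟨x, hx⟩).exp_mul (hb ⟨x, hx⟩).neg).congr fun p hp => hΨ _ p hp
  · intro y hy
    have hyB : y ∈ B ⟨y, hy.1⟩ \ V := ⟨hxB ⟨y, hy.1⟩, hy.2⟩
    have hnhds := ((hB ⟨y, hy.1⟩).sdiff hV.1).mem_nhds hyB
    refine ContMDiffAt.contMDiffWithinAt ?_
    refine ContMDiffAt.congr_of_eventuallyEq
      ((((hb ⟨y, hy.1⟩).mono sdiff_subset).add (hfs ⟨y, hy.1⟩)).contMDiffAt hnhds) ?_
    filter_upwards [hnhds] with z hz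
    exact hu _ z hz
  · intro p hp
    have hpB : p.proj ∈ B ⟨p.proj, hp.1⟩ \ V := ⟨hxB ⟨p.proj, hp.1⟩, hp.2⟩
    rw [hu _ _ hpB, hΨ _ p hpB.1, hΦf _ p hpB, ← mul_assoc, ← Complex.exp_add]
    congr 2
    ring

theorem exists_trivialization_extension_of_finset [T2Space M] [SecondCountableTopology M]
    [IsManifold (𝓡 m) ∞ M] {ι : Type*} {V : ι → Set M} {d : ι → ℕ}
    (hV : ∀ i, IsClosedSubmanifold m (d i) (V i)) (hd : ∀ i, 3 ≤ d i) (s : Finset ι) :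
    ∀ {U : Set M}, IsOpen U → ∀ Φ : TotalSpace ℂ L → ℂ,
      IsTrivializationOn m ⊤ (U \ ⋃ i ∈ s, V i) Φ →
      ∃ Ψ : TotalSpace ℂ L → ℂ, IsTrivializationOn m ⊤ U Ψ ∧
        ∃ u : M → ℂ, ContMDiffOn (𝓡 m) 𝓘(ℝ, ℂ) ∞ u (U \ ⋃ i ∈ s, V i) ∧
          ∀ p : TotalSpace ℂ L, p.proj ∈ U \ ⋃ i ∈ s, V i →
            Φ p = Complex.exp (u p.proj) * Ψ p := by
  classical
  induction s using Finset.induction_on with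
  | empty =>
    exact fun _ Φ hΦ => ⟨Φ, by simpa using hΦ, 0, contMDiffOn_const, fun p _ => by simp⟩
  | insert i s _ ih =>
    intro U hU Φ hΦ
    have hset : U \ ⋃ j ∈ insert i s, V j = (U \ V i) \ ⋃ j ∈ s, V j := by
      rw [Finset.set_biUnion_insert, sdiff_sdiff]
    rw [hset] at hΦ ⊢
    obtain ⟨Ψ₁, hΨ₁, u₁, hu₁, he₁⟩ := ih (hU.sdiff (hV i).1) Φ hΦ
    obtain ⟨Ψ₂, hΨ₂, u₂, hu₂, he₂⟩ := (hV i).exists_trivialization_extension (hd i) hU hΨ₁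
    refine ⟨Ψ₂, hΨ₂, fun y => u₁ y + u₂ y, hu₁.add (hu₂.mono sdiff_subset), fun p hp => ?_⟩
    rw [he₁ p hp, he₂ p hp.1, ← mul_assoc, ← Complex.exp_add]

end

end

theorem corollary5p4 {m : ℕ} {M : Type*} [TopologicalSpace M] [T2Space M]
    [SecondCountableTopology M] [ChartedSpace (EuclideanSpace ℝ (Fin m)) M]
    [IsManifold (𝓡 m) ∞ M]
    {L : M → Type*} [TopologicalSpace (TotalSpace ℂ L)]
    [∀ x, NormedAddCommGroup (L x)] [∀ x, InnerProductSpace ℂ (L x)]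
    [FiberBundle ℂ L] [VectorBundle ℂ ℂ L] [ContMDiffVectorBundle ∞ ℂ L (𝓡 m)]
    [IsContMDiffRiemannianBundle (𝓡 m) ∞ ℂ L]
    (D : CovariantDerivative (𝓡 m) ℂ L) (_hD : IsHermitianConnection D)
    (c ℓ : ℕ) (V : Fin ℓ → Set M)
    (hV : ∀ i, ∃ d : ℕ, c ≤ d ∧ IsClosedSubmanifold m d (V i))
    (M' : Set M) (hM' : M' = (⋃ i, V i)ᶜ) :
    (2 ≤ c → ∀ (r : ℕ∞) (Φ Φ' : TotalSpace ℂ L → ℂ),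
      IsTrivializationOn m r univ Φ → IsTrivializationOn m r univ Φ' →
      TrivializationsHomotopicOn m r M' Φ Φ' → TrivializationsHomotopicOn m r univ Φ Φ') ∧
    (3 ≤ c → ∀ Φ : TotalSpace ℂ L → ℂ, IsTrivializationOn m (⊤ : ℕ∞) M' Φ →
      ∃ Ψ : TotalSpace ℂ L → ℂ, IsTrivializationOn m (⊤ : ℕ∞) univ Ψ ∧
        TrivializationsHomotopicOn m (⊤ : ℕ∞) M' Φ Ψ) := by
  choose d hcd hV using hV
  have hset : M' = univ \ ⋃ i ∈ Finset.univ, V i := by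
    rw [hM', compl_eq_univ_sdiff]
    simp
  subst hset
  refine ⟨fun hc r Φ Φ' hΦ hΦ' h => ?_, fun hc Φ hΦ => ?_⟩
  · obtain ⟨f, hf, hfe⟩ := h.exists_log (hΦ.mono (subset_univ _))
    have hr := contMDiffOn_trivializationRatio hΦ hΦ'
    obtain ⟨f', hf', hfe'⟩ := exists_log_extension_of_finset hV (fun i => hc.trans (hcd i))
      Finset.univ isOpen_univ hr.continuousOn
      (fun y hy => trivializationRatio_ne_zero hΦ hΦ' hy) f hf hfe
    refine .of_eq_exp_mul hΦ (hf'.contMDiffOn_log hr hfe') fun p hp => ?_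
    rw [hfe' _ hp]
    exact eq_trivializationRatio_mul hΦ hΦ' p hp
  · obtain ⟨Ψ, hΨ, u, hu, he⟩ := exists_trivialization_extension_of_finset hV
      (fun i => hc.trans (hcd i)) Finset.univ isOpen_univ Φ hΦ
    -- The sign changes because the homotopy starts at `Φ`: `Ψ = exp (-u) * Φ`.
    refine ⟨Ψ, hΨ, .of_eq_exp_mul hΦ hu.neg fun p hp => ?_⟩
    rw [he p hp, ← mul_assoc, ← Complex.exp_add]
    simp
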